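/- Let $\mathcal G=(\mathcal V,\mathcal E,A)$ be a weighted digraph on a finite nonempty node set $\mathcal V$, without self-loops, where $A=[a_{ij}]$ is a nonnegative real matrix with $a_{ij}>0$ if and only if $(j,i)\in\mathcal E$ (that is, there is an edge from $j$ to $i$). Its Laplacian $L=[l_{ij}]$ is given by $l_{ii}=\sum_{j:(j,i)\in\mathcal E}a_{ij}$, $l_{ij}=-a_{ij}$ if $(j,i)\in\mathcal E$, and $l_{ij}=0$ otherwise; consider the network $\dot x=-Lx$ on $[0,\infty)$. A set $\mathcal S\subseteq\mathcal V$ is a topological cluster if it is inclusion-maximal among the sets of nodes with the following property: for every choice of positive weights on the edges $\mathcal E$ and every initial value $x(0)$, the states $x_i(t)$ of all nodes $i$ of the set converge, as $t\to\infty$, to a common value (which may depend on the weights and on $x(0)$). Let $\mathcal G[\mathcal S]$ denote the subgraph induced by $\mathcal S$. A directed spanning tree of $\mathcal G[\mathcal S]$ is a subgraph with node set $\mathcal S$ in which one node, the root, has no parent, every other node has exactly one parent, and every node is reachable from the root; a root node of $\mathcal G[\mathcal S]$ is the root of some directed spanning tree of $\mathcal G[\mathcal S]$. Theorem. A set $\mathcal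 S\subseteq\mathcal V$ is a topological cluster if and only if $\mathcal S$ is inclusion-maximal among the subsets of $\mathcal V$ that satisfy both of the following conditions: (C1) the induced subgraph $\mathcal G[\mathcal S]$ has at least one directed spanning tree; (C2) either no node of $\mathcal S$ has an incoming edge from $\mathcal V\setminus\mathcal S$, or exactly one node of $\mathcal S$ has incoming edges from $\mathcal V\setminus\mathcal S$ and this node is a root node of $\mathcal G[\mathcal S]$. -/

import Mathlib

open Filter Topology

/-- The subgraph of a digraph induced by a set `S` of nodes. -/
def inducedDigraph {V : Type*} (D : Digraph V) (S : Set V) : Digraph S :=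
  ⟨fun u v => D.Adj u v⟩

/-- `T` is a directed tree with root `r`: the root has no parent, every other node has exactly
one parent, and every node can be reached from the root along edges. -/
def IsDirectedTree {W : Type*} (T : Digraph W) (r : W) : Prop :=
  (∀ u, ¬ T.Adj u r) ∧
  (∀ v, v ≠ r → ∃! u, T.Adj u v) ∧
  (∀ v, Relation.ReflTransGen T.Adj r v)

/-- `r` is a root node of `D`: the root of some directed spanning tree of `D`
(`T ≤ D` says that every edge of `T` is an edge of `D`; the node sets coincide). -/
def IsRootNode {W : Type*} (D : Digraph W) (r : W) : Prop :=
  ∃ T : Digraph W, T ≤ D ∧ IsDirectedTree T r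

/-- `D` has at least one directed spanning tree. -/
def HasSpanningTree {W : Type*} (D : Digraph W) : Prop :=
  ∃ r, IsRootNode D r

/-- A weighted digraph without self-loops. `Adj i j` says that `(i, j)` is an edge (from `i`
to `j`), and `weight i j` is the weight `a_ij` of the edge `(j, i)`. -/
structure WeightedDigraph (V : Type*) extends Digraph V where
  loopless : ∀ i, ¬ Adj i i
  weight : Matrix V V ℝ
  weight_nonneg : ∀ i j, 0 ≤ weight i j
  weight_pos_iff : ∀ i j, 0 < weight i j ↔ Adj j i

namespace WeightedDigraph

variable {V : Type*}

open Classical in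
/-- The Laplacian matrix of a weighted digraph. -/
noncomputable def laplacian [Fintype V] (G : WeightedDigraph V) : Matrix V V ℝ :=
  Matrix.of fun i j =>
    if i = j then ∑ k with G.Adj k i, G.weight i k
    else if G.Adj j i then -G.weight i j
    else 0

/-- `x` solves `ẋ = -L x` on `[0, ∞)`, with an arbitrary initial value. -/
def IsTrajectory [Fintype V] (G : WeightedDigraph V) (x : ℝ → V → ℝ) : Prop :=
  ∀ t, 0 ≤ t → HasDerivWithinAt x (-(G.laplacian.mulVec (x t))) (Set.Ici 0) t

/-- The nodes of `S` converge to an identical value independently of the edge weights: for all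
positive weights on the edges of `G` and all initial values, the states of the nodes of `S`
converge to a common value (which may depend on the weights and on the initial values). -/
def ConvergesIdentically [Fintype V] (G : WeightedDigraph V) (S : Set V) : Prop :=
  ∀ H : WeightedDigraph V, H.toDigraph = G.toDigraph →
    ∀ x : ℝ → V → ℝ, H.IsTrajectory x →
      ∃ c : ℝ, ∀ i ∈ S, Tendsto (fun t => x t i) atTop (𝓝 c)

/-- A topological cluster is an inclusion-maximal set of nodes that converge to an identical
value independently of the edge weights. -/
def IsTopologicalCluster [Fintype V] (G : WeightedDigraph V) (S : Set V) : Prop :=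
  Maximal G.ConvergesIdentically S

/-- The nodes of `S` that have an incoming edge from outside `S`. -/
def entryNodes (G : WeightedDigraph V) (S : Set V) : Set V :=
  {i | i ∈ S ∧ ∃ j, j ∉ S ∧ G.Adj j i}

/-- The induced subgraph has at least one directed spanning tree. -/
def CondC1 (G : WeightedDigraph V) (S : Set V) : Prop :=
  HasSpanningTree (inducedDigraph G.toDigraph S)

/-- Either no node of `S` has an incoming edge from outside `S`, or exactly one node of `S` has
one and this node is a root node of the induced subgraph. -/
def CondC2 (G : WeightedDigraph V) (S : Set V) : Prop :=
  G.entryNodes S = ∅ ∨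
  ∃ r : S, IsRootNode (inducedDigraph G.toDigraph S) r ∧ G.entryNodes S = {(r : V)}

end WeightedDigraph

/-!
With `K` the sum of all weights, `K - L` has norm at most `K` for the sup norm. For any linear map
`f` with `‖K • v - f v‖ ≤ K * ‖v‖`, the velocity of a solution of `ẏ = -f y` has nonincreasing norm
and turns so slowly that over long times the solution would travel along an almost straight line;
as solutions are bounded, the velocity tends to zero. The range and the kernel of `f` are then
complementary, so that every trajectory of the network converges to an equilibrium. Conditions (C1)
and (C2) say that `S` is rooted: some node of `S` reaches all others along edges into nodes whose
predecessors all lie in `S`. By the maximum principle an equilibrium is then constant on `S`.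

Conversely, `h` is an equilibrium for some weights exactly if it is balanced: a node with a
predecessor of smaller value has one of larger value, and vice versa. If two nodes of a level set of
`h` have no common ancestor inside that level set, a harmonic function that is one on the ancestors
of the first and zero on those of the second separates them, and breaking the ties of `h` by this
function gives a finer balanced function. The finest balanced functions therefore have rooted level
sets, and a set whose nodes always converge to a common value lies in one of them.
-/

section LinearFlow

open Real Set

variable {E : Type*} [NormedAddCommGroup E] [NormedSpace ℝ E]

/-- `y` solves `ẏ = -f y` on `[0, ∞)`; the sign is chosen to match `ẋ = -L x`. -/
def IsLinearFlow (f : E →L[ℝ] E) (y : ℝ → E) : Prop :=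
  ∀ t, 0 ≤ t → HasDerivWithinAt y (-(f (y t))) (Ici 0) t

namespace IsLinearFlow

variable {f : E →L[ℝ] E} {y : ℝ → E} {K : ℝ}

theorem continuousOn (hy : IsLinearFlow f y) : ContinuousOn y (Ici 0) :=
  fun t ht => (hy t ht).continuousWithinAt

theorem comp_const_add (hy : IsLinearFlow f y) {s : ℝ} (hs : 0 ≤ s) :
    IsLinearFlow f fun t => y (s + t) := by
  intro t ht
  have hshift : HasDerivWithinAt (fun t => s + t) 1 (Ici 0) t :=
    (hasDerivAt_id t).hasDerivWithinAt.const_add s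
  simpa [Function.comp_def] using
    (hy (s + t) (add_nonneg hs ht)).scomp t hshift fun r hr => add_nonneg hs hr

theorem map (hy : IsLinearFlow f y) {g : E →L[ℝ] E} (hg : Commute f g) :
    IsLinearFlow f fun t => g (y t) := by
  intro t ht
  have hcomm : f (g (y t)) = g (f (y t)) := DFunLike.congr_fun hg.eq (y t)
  simpa [hcomm, Function.comp_def] using g.hasFDerivAt.comp_hasDerivWithinAt t (hy t ht)

theorem hasDerivWithinAt_exp_smul (hy : IsLinearFlow f y) (K : ℝ) {t : ℝ} (ht : 0 ≤ t) :
    HasDerivWithinAt (fun s => exp (K * s) • y s) (exp (K * t) • (K • y t - f (y t)))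
      (Ici 0) t := by
  have hexp : HasDerivAt (fun s => exp (K * s)) (exp (K * t) * K) t := by
    simpa using ((hasDerivAt_id t).const_mul K).exp
  refine (hexp.hasDerivWithinAt.smul (hy t ht)).congr_deriv ?_
  module

theorem apply_eq_of_forall_apply_eq_zero {F : Type*} [NormedAddCommGroup F] [NormedSpace ℝ F]
    (hy : IsLinearFlow f y) {g : E →L[ℝ] F} (hg : ∀ v, g (f v) = 0) {t : ℝ} (ht : 0 ≤ t) :
    g (y t) = g (y 0) := by
  have hderiv : ∀ s ∈ Ico 0 t, HasDerivWithinAt (fun s => g (y s)) 0 (Ici s) s := by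
    intro s hs
    simpa [hg, Function.comp_def] using g.hasFDerivAt.comp_hasDerivWithinAt s
      ((hy s hs.1).mono (Ici_subset_Ici.2 hs.1))
  exact constant_of_has_deriv_right_zero
    (g.continuous.comp_continuousOn (hy.continuousOn.mono Icc_subset_Ici_self)) hderiv t
    (right_mem_Icc.2 ht)

theorem norm_le (hy : IsLinearFlow f y) (hf : ∀ v, ‖K • v - f v‖ ≤ K * ‖v‖) {t : ℝ}
    (ht : 0 ≤ t) : ‖y t‖ ≤ ‖y 0‖ := by
  have hgronwall := norm_le_gronwallBound_of_norm_deriv_right_le (δ := ‖y 0‖) (K := K) (ε := 0)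
    (f := fun s => exp (K * s) • y s) (b := t)
    (fun s hs => (hy.hasDerivWithinAt_exp_smul K hs.1).continuousWithinAt.mono Icc_subset_Ici_self)
    (fun s hs => (hy.hasDerivWithinAt_exp_smul K hs.1).mono (Ici_subset_Ici.2 hs.1))
    (by simp)
    (fun s _ => by
      rw [norm_smul, norm_smul, add_zero, mul_left_comm]
      gcongr
      exact hf (y s))
    t (right_mem_Icc.2 ht)
  rw [gronwallBound_ε0, sub_zero, norm_smul, norm_of_nonneg (exp_pos _).le, mul_comm] at hgronwall
  exact le_of_mul_le_mul_right hgronwall (exp_pos _)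

theorem antitoneOn_norm (hy : IsLinearFlow f y) (hf : ∀ v, ‖K • v - f v‖ ≤ K * ‖v‖) :
    AntitoneOn (fun t => ‖y t‖) (Ici 0) := by
  intro s hs t _ hst
  simpa using (hy.comp_const_add hs).norm_le hf (sub_nonneg.2 hst)

theorem sub_exp_mul_le_dual_apply (hy : IsLinearFlow f y) (hf : ∀ v, ‖K • v - f v‖ ≤ K * ‖v‖)
    (hK : 0 ≤ K) {φ : StrongDual ℝ E} (hφ : ‖φ‖ ≤ 1) {t T : ℝ} (ht : 0 ≤ t) (htT : t ≤ T) :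
    ‖y 0‖ - exp (K * (T - t)) * (‖y 0‖ - φ (y T)) ≤ φ (y t) := by
  have hderiv : ∀ s, 0 ≤ s → HasDerivWithinAt
      (fun s => exp (K * s) * ‖y 0‖ - φ (exp (K * s) • y s))
      (exp (K * s) * K * ‖y 0‖ - φ (exp (K * s) • (K • y s - f (y s)))) (Ici 0) s := by
    intro s hs
    have hexp : HasDerivAt (fun s => exp (K * s)) (exp (K * s) * K) s := by
      simpa using ((hasDerivAt_id s).const_mul K).exp
    exact (hexp.mul_const _).hasDerivWithinAt.sub
      (φ.hasFDerivAt.comp_hasDerivWithinAt s (hy.hasDerivWithinAt_exp_smul K hs))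
  have hmono : MonotoneOn (fun s => exp (K * s) * ‖y 0‖ - φ (exp (K * s) • y s)) (Ici 0) := by
    refine monotoneOn_of_hasDerivWithinAt_nonneg (convex_Ici 0)
      (fun s hs => (hderiv s hs).continuousWithinAt)
      (fun s hs => (hderiv s (interior_subset hs)).mono interior_subset) fun s hs => ?_
    have hs0 : 0 ≤ s := interior_subset hs
    rw [map_smul, smul_eq_mul, mul_assoc, ← mul_sub]
    refine mul_nonneg (exp_pos _).le (sub_nonneg.2 ?_)
    calc φ (K • y s - f (y s)) ≤ ‖K • y s - f (y s)‖ :=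
          (le_abs_self _).trans (φ.le_of_opNorm_le_of_le hφ le_rfl |>.trans_eq (one_mul _))
      _ ≤ K * ‖y s‖ := hf (y s)
      _ ≤ K * ‖y 0‖ := by gcongr; exact hy.norm_le hf hs0
  have hle := hmono ht (ht.trans htT) htT
  simp only [map_smul, smul_eq_mul, ← mul_sub] at hle
  have hexp : exp (K * T) = exp (K * t) * exp (K * (T - t)) := by rw [← exp_add]; ring_nf
  rw [hexp, mul_assoc] at hle
  linarith [le_of_mul_le_mul_left hle (exp_pos _)]

-- A functional norming `f (y T)` is almost norming for `f (y t)` at all earlier times, so that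
-- `y` travels nearly straight during `[0, T]`, at a speed close to `‖f (y 0)‖`.
theorem mul_sub_exp_mul_le_norm_sub (hy : IsLinearFlow f y)
    (hf : ∀ v, ‖K • v - f v‖ ≤ K * ‖v‖) (hK : 0 ≤ K) {T : ℝ} (hT : 0 ≤ T) :
    (‖f (y 0)‖ - exp (K * T) * (‖f (y 0)‖ - ‖f (y T)‖)) * T ≤ ‖y 0 - y T‖ := by
  set m := ‖f (y 0)‖ - exp (K * T) * (‖f (y 0)‖ - ‖f (y T)‖)
  have hfy : IsLinearFlow f fun t => f (y t) := hy.map (Commute.refl f)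
  obtain ⟨φ, hφ, hφT⟩ := exists_dual_vector'' ℝ (f (y T))
  have hspeed : ∀ t ∈ Icc 0 T, m ≤ φ (f (y t)) := by
    intro t ht
    refine le_trans ?_ (hfy.sub_exp_mul_le_dual_apply hf hK hφ ht.1 ht.2)
    have hdrop : 0 ≤ ‖f (y 0)‖ - ‖f (y T)‖ := sub_nonneg.2 (hfy.norm_le hf hT)
    rw [hφT, RCLike.ofReal_real_eq_id, id]
    have htime : K * (T - t) ≤ K * T := mul_le_mul_of_nonneg_left (sub_le_self T ht.1) hK
    exact sub_le_sub_left (mul_le_mul_of_nonneg_right (exp_le_exp.2 htime) hdrop) _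
  have hderiv : ∀ t ∈ interior (Icc 0 T), HasDerivAt (fun t => φ (y t)) (-φ (f (y t))) t := by
    intro t ht
    rw [interior_Icc] at ht
    simpa [Function.comp_def] using φ.hasFDerivAt.comp_hasDerivAt t
      ((hy t ht.1.le).hasDerivAt (Ici_mem_nhds ht.1))
  have hmean := (convex_Icc 0 T).image_sub_le_mul_sub_of_deriv_le (C := -m)
    (φ.continuous.comp_continuousOn (hy.continuousOn.mono Icc_subset_Ici_self))
    (fun t ht => (hderiv t ht).differentiableAt.differentiableWithinAt)
    (fun t ht => (hderiv t ht).deriv ▸ neg_le_neg (hspeed t (interior_subset ht)))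
    0 (left_mem_Icc.2 hT) T (right_mem_Icc.2 hT) hT
  calc m * T ≤ φ (y 0 - y T) := by rw [map_sub]; simp only [Function.comp] at hmean; linarith
    _ ≤ ‖y 0 - y T‖ :=
      (le_abs_self _).trans (φ.le_of_opNorm_le_of_le hφ le_rfl |>.trans_eq (one_mul _))

theorem tendsto_apply_zero (hy : IsLinearFlow f y) (hf : ∀ v, ‖K • v - f v‖ ≤ K * ‖v‖)
    (hK : 0 ≤ K) : Tendsto (fun t => f (y t)) atTop (𝓝 0) := by
  have hanti := (hy.map (Commute.refl f)).antitoneOn_norm hf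
  obtain ⟨c, hc⟩ : ∃ c, Tendsto (fun t => ‖f (y t)‖) atTop (𝓝 c) := by
    have hmax : Antitone fun t => ‖f (y (max t 0))‖ := fun s t hst =>
      hanti (le_max_right s 0) (le_max_right t 0) (max_le_max_right 0 hst)
    refine ⟨_, (tendsto_atTop_ciInf hmax ⟨0, ?_⟩).congr' ?_⟩
    · rintro _ ⟨t, rfl⟩
      exact norm_nonneg _
    · filter_upwards [eventually_ge_atTop 0] with t ht
      rw [max_eq_left ht]
  have hbound : ∀ T, 0 ≤ T → c * T ≤ 2 * ‖y 0‖ := by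
    intro T hT
    have hlim : Tendsto (fun s => (‖f (y s)‖ - exp (K * T) * (‖f (y s)‖ - ‖f (y (s + T))‖)) * T)
        atTop (𝓝 ((c - exp (K * T) * (c - c)) * T)) :=
      (hc.sub ((hc.sub (hc.comp (tendsto_atTop_add_const_right _ T tendsto_id))).const_mul
        _)).mul_const T
    rw [sub_self, mul_zero, sub_zero] at hlim
    refine le_of_tendsto hlim ?_
    filter_upwards [eventually_ge_atTop 0] with s hs
    have hspeed := (hy.comp_const_add hs).mul_sub_exp_mul_le_norm_sub hf hK hT
    rw [add_zero] at hspeed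
    calc _ ≤ ‖y s - y (s + T)‖ := hspeed
      _ ≤ ‖y s‖ + ‖y (s + T)‖ := norm_sub_le _ _
      _ ≤ ‖y 0‖ + ‖y 0‖ :=
        add_le_add (hy.norm_le hf hs) (hy.norm_le hf (add_nonneg hs hT))
      _ = 2 * ‖y 0‖ := (two_mul _).symm
  have hc0 : c = 0 := by
    refine le_antisymm (not_lt.1 fun hpos => ?_) (ge_of_tendsto' hc fun t => norm_nonneg _)
    have := hbound ((2 * ‖y 0‖ + 1) / c) (by positivity)
    rw [mul_div_cancel₀ _ hpos.ne'] at this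
    linarith
  exact tendsto_zero_iff_norm_tendsto_zero.2 (hc0 ▸ hc)

end IsLinearFlow

variable {f : E →L[ℝ] E} {K : ℝ}

-- Otherwise `t ↦ v - t • f v` would be a flow of constant nonzero velocity.
theorem disjoint_range_ker_of_norm_smul_sub_le (hf : ∀ v, ‖K • v - f v‖ ≤ K * ‖v‖)
    (hK : 0 ≤ K) : Disjoint f.range f.ker := by
  rw [Submodule.disjoint_def]
  rintro _ ⟨v, rfl⟩ (hv : f (f v) = 0)
  have hline : IsLinearFlow f fun t => v - t • f v := by
    intro t _
    simpa [hv] using (((hasDerivAt_id t).smul_const (f v)).const_sub v).hasDerivWithinAt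
  have hlim := hline.tendsto_apply_zero hf hK
  simp only [map_sub, map_smul, hv, smul_zero, sub_zero] at hlim
  exact tendsto_nhds_unique tendsto_const_nhds hlim

theorem isCompl_range_ker_of_norm_smul_sub_le [FiniteDimensional ℝ E]
    (hf : ∀ v, ‖K • v - f v‖ ≤ K * ‖v‖) (hK : 0 ≤ K) : IsCompl f.range f.ker :=
  have hdisj := disjoint_range_ker_of_norm_smul_sub_le hf hK
  ⟨hdisj, codisjoint_iff.2 (Submodule.eq_top_of_disjoint _ _
    (LinearMap.finrank_range_add_finrank_ker f.toLinearMap).ge hdisj)⟩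

theorem IsLinearFlow.exists_tendsto [FiniteDimensional ℝ E] {y : ℝ → E} (hy : IsLinearFlow f y)
    (hf : ∀ v, ‖K • v - f v‖ ≤ K * ‖v‖) (hK : 0 ≤ K) : ∃ l, Tendsto y atTop (𝓝 l) ∧ f l = 0 := by
  have hcompl := isCompl_range_ker_of_norm_smul_sub_le hf hK
  let P : E →L[ℝ] E := (f.ker.projection f.range hcompl.symm).toContinuousLinearMap
  have hPrange : ∀ v, P (f v) = 0 := fun v =>
    Submodule.projection_apply_of_mem_right hcompl.symm ⟨v, rfl⟩
  have hPker : ∀ v, f (P v) = 0 := fun v => Submodule.projection_apply_mem hcompl.symm v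
  have hPid : ∀ v, f v = 0 → P v = v := fun v hv =>
    Submodule.projection_apply_of_mem_left hcompl.symm hv
  have hinj : (f + P).ker = ⊥ := by
    refine LinearMap.ker_eq_bot'.2 fun v (hv : f v + P v = 0) => ?_
    have hPv : P v = 0 := by simpa [hPrange, hPid _ (hPker v)] using congrArg P hv
    have hfv : f v = 0 := by simpa [hPv] using hv
    rw [← hPid v hfv, hPv]
  refine ⟨P (y 0), ?_, hPker _⟩
  refine (LinearMap.isClosedEmbedding_of_injective hinj).isInducing.tendsto_nhds_iff.2 ?_
  have hlimit : (f + P) (P (y 0)) = 0 + P (y 0) := by simp [hPker, hPid _ (hPker _)]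
  simp only [ContinuousLinearMap.coe_coe, hlimit]
  refine ((hy.tendsto_apply_zero hf hK).add_const (P (y 0))).congr' ?_
  filter_upwards [eventually_ge_atTop 0] with t ht
  simp [hy.apply_eq_of_forall_apply_eq_zero hPrange ht]

end LinearFlow

section Laplacian

namespace WeightedDigraph

variable {V : Type*} {G : WeightedDigraph V}

theorem weight_eq_zero {i j : V} (h : ¬ G.Adj j i) : G.weight i j = 0 :=
  le_antisymm (not_lt.1 fun hlt => h ((G.weight_pos_iff i j).1 hlt)) (G.weight_nonneg i j)

variable [Fintype V]

theorem laplacian_apply_self (i : V) : G.laplacian i i = ∑ k, G.weight i k := by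
  classical
  rw [laplacian, Matrix.of_apply, if_pos rfl]
  exact Finset.sum_subset (Finset.filter_subset _ _) fun k _ hk =>
    weight_eq_zero fun hadj => hk (Finset.mem_filter.2 ⟨Finset.mem_univ k, hadj⟩)

theorem laplacian_apply_of_ne {i j : V} (hij : i ≠ j) : G.laplacian i j = -G.weight i j := by
  rw [laplacian, Matrix.of_apply, if_neg hij]
  split_ifs with h
  · rfl
  · rw [weight_eq_zero h, neg_zero]

theorem laplacian_mulVec_apply (x : V → ℝ) (i : V) :
    G.laplacian.mulVec x i = ∑ k, G.weight i k * (x i - x k) := by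
  classical
  have hterm : ∀ k, G.laplacian i k * x k =
      (if k = i then (∑ j, G.weight i j) * x i else 0) - G.weight i k * x k := by
    intro k
    rcases eq_or_ne k i with rfl | hk
    · rw [laplacian_apply_self, if_pos rfl, weight_eq_zero (G.loopless k), zero_mul, sub_zero]
    · rw [laplacian_apply_of_ne hk.symm, if_neg hk, zero_sub, neg_mul]
  simp only [Matrix.mulVec, dotProduct, hterm, Finset.sum_sub_distrib, Finset.sum_ite_eq',
    Finset.mem_univ, if_true, Finset.sum_mul, mul_sub]

theorem eq_of_adj_of_laplacian_mulVec_eq_zero {x : V → ℝ} {i j : V}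
    (hx : G.laplacian.mulVec x i = 0) (hmax : ∀ k, G.Adj k i → x k ≤ x i) (hj : G.Adj j i) :
    x j = x i := by
  rw [laplacian_mulVec_apply] at hx
  have hterm : ∀ k ∈ Finset.univ, 0 ≤ G.weight i k * (x i - x k) := by
    intro k _
    by_cases hk : G.Adj k i
    · exact mul_nonneg (G.weight_nonneg i k) (sub_nonneg.2 (hmax k hk))
    · rw [weight_eq_zero hk, zero_mul]
  have hzero := (Finset.sum_eq_zero_iff_of_nonneg hterm).1 hx j (Finset.mem_univ j)
  exact (sub_eq_zero.1
    ((mul_eq_zero.1 hzero).resolve_left ((G.weight_pos_iff i j).2 hj).ne')).symm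

theorem norm_smul_sub_laplacian_mulVec_le {K : ℝ} (hK : ∀ i, ∑ k, G.weight i k ≤ K)
    (x : V → ℝ) : ‖K • x - G.laplacian.mulVec x‖ ≤ K * ‖x‖ := by
  rcases isEmpty_or_nonempty V with _ | ⟨⟨i₀⟩⟩
  · simp [Subsingleton.elim x 0]
  have hK₀ : 0 ≤ K := (Finset.sum_nonneg fun k _ => G.weight_nonneg i₀ k).trans (hK i₀)
  refine (pi_norm_le_iff_of_nonneg (mul_nonneg hK₀ (norm_nonneg x))).2 fun i => ?_
  have hcoord : (K • x - G.laplacian.mulVec x) i =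
      (K - ∑ k, G.weight i k) * x i + ∑ k, G.weight i k * x k := by
    simp only [Pi.sub_apply, Pi.smul_apply, smul_eq_mul, laplacian_mulVec_apply, mul_sub,
      Finset.sum_sub_distrib]
    rw [sub_mul, Finset.sum_mul, sub_sub_eq_add_sub, sub_add_eq_add_sub]
  calc ‖(K • x - G.laplacian.mulVec x) i‖
      ≤ (K - ∑ k, G.weight i k) * ‖x‖ + ∑ k, G.weight i k * ‖x‖ := by
        rw [hcoord]
        refine norm_add_le_of_le ?_ (norm_sum_le_of_le _ fun k _ => ?_)
        · rw [norm_mul, Real.norm_of_nonneg (sub_nonneg.2 (hK i))]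
          exact mul_le_mul_of_nonneg_left (norm_le_pi_norm x i) (sub_nonneg.2 (hK i))
        · rw [norm_mul, Real.norm_of_nonneg (G.weight_nonneg i k)]
          exact mul_le_mul_of_nonneg_left (norm_le_pi_norm x k) (G.weight_nonneg i k)
    _ = K * ‖x‖ := by rw [← Finset.sum_mul, sub_mul, sub_add_cancel]

theorem IsTrajectory.exists_tendsto {x : ℝ → V → ℝ} (hx : G.IsTrajectory x) :
    ∃ l, Tendsto x atTop (𝓝 l) ∧ G.laplacian.mulVec l = 0 := by
  have hrow : ∀ i, 0 ≤ ∑ k, G.weight i k :=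
    fun i => Finset.sum_nonneg fun k _ => G.weight_nonneg i k
  have hK : ∀ i, ∑ k, G.weight i k ≤ ∑ i, ∑ k, G.weight i k := fun i =>
    Finset.single_le_sum (fun j _ => hrow j) (Finset.mem_univ i)
  have hflow : IsLinearFlow G.laplacian.mulVecLin.toContinuousLinearMap x := hx
  exact hflow.exists_tendsto (norm_smul_sub_laplacian_mulVec_le hK)
    (Finset.sum_nonneg fun i _ => hrow i)

theorem isTrajectory_const {l : V → ℝ} (hl : G.laplacian.mulVec l = 0) :
    G.IsTrajectory fun _ => l := by
  intro t _
  simpa [hl] using hasDerivWithinAt_const t (Set.Ici (0 : ℝ)) l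

end WeightedDigraph

end Laplacian

section Reachability

open Relation

variable {W : Type*} {E : W → W → Prop}

theorem exists_depth_of_forall_reflTransGen {r : W} (hr : ∀ v, ReflTransGen E r v) :
    ∃ d : W → ℕ, ∀ v, v ≠ r → ∃ u, E u v ∧ d u < d v := by
  classical
  let layer : ℕ → Set W := fun n => (fun S => {v | ∃ u ∈ S, E u v})^[n] {r}
  have hlayer : ∀ n, layer (n + 1) = {v | ∃ u ∈ layer n, E u v} := fun n =>
    Function.iterate_succ_apply' _ n _
  have hmem : ∀ v, ∃ n, v ∈ layer n := by
    intro v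
    induction hr v with
    | refl => exact ⟨0, rfl⟩
    | tail _ hbc ih =>
      obtain ⟨n, hn⟩ := ih
      exact ⟨n + 1, (hlayer n).symm ▸ ⟨_, hn, hbc⟩⟩
  refine ⟨fun v => Nat.find (hmem v), fun v hv => ?_⟩
  have hspec := Nat.find_spec (hmem v)
  rcases hn : Nat.find (hmem v) with _ | n <;> rw [hn] at hspec
  · exact absurd hspec hv
  · rw [hlayer] at hspec
    obtain ⟨u, hu, huv⟩ := hspec
    exact ⟨u, huv, (Nat.lt_succ_of_le (Nat.find_min' (hmem u) hu)).trans_eq hn.symm⟩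

theorem isRootNode_iff {D : Digraph W} {r : W} :
    IsRootNode D r ↔ ∀ v, ReflTransGen D.Adj r v := by
  refine ⟨fun ⟨T, hT, _, _, h⟩ v => (ReflTransGen.mono fun _ _ hab => hT hab) _ _ (h v),
    fun h => ?_⟩
  obtain ⟨d, hd⟩ := exists_depth_of_forall_reflTransGen h
  choose! parent hadj hlt using hd
  refine ⟨⟨fun u v => v ≠ r ∧ u = parent v⟩, ?_, fun u hu => hu.1 rfl,
    fun v hv => ⟨parent v, ⟨hv, rfl⟩, fun u hu => hu.2⟩, fun v => ?_⟩
  · rintro u v ⟨hv, rfl⟩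
    exact hadj v hv
  · induction hn : d v using Nat.strong_induction_on generalizing v with
    | _ n ih =>
      rcases eq_or_ne v r with rfl | hv
      · exact .refl
      · exact (ih _ (hn ▸ hlt v hv) (parent v) rfl).tail ⟨hv, rfl⟩

/-- The edges of `E` whose head receives edges from `T` only: along these edges a maximum over `T`
propagates backwards. -/
def innerRel (E : W → W → Prop) (T : Set W) (j i : W) : Prop :=
  E j i ∧ ∀ k, E k i → k ∈ T

/-- The conditions (C1) and (C2) merged: some `r ∈ T` reaches every node of `T` along edges of
`E` whose heads have all their predecessors in `T`. In particular only `r` may have predecessors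
outside `T`. -/
def IsRootedSet (E : W → W → Prop) (T : Set W) : Prop :=
  ∃ r ∈ T, ∀ v ∈ T, ReflTransGen (innerRel E T) r v

theorem reflTransGen_innerRel_of_induced {D : Digraph W} {T : Set W} {r v : T}
    (hT : ∀ i ∈ T, i ≠ (r : W) → ∀ k, D.Adj k i → k ∈ T)
    (hv : ReflTransGen (inducedDigraph D T).Adj r v) : ReflTransGen (innerRel D.Adj T) r v := by
  induction hv with
  | refl => exact .refl
  | @tail b c _ hbc ih =>
    by_cases hc : (c : W) = r
    · rw [hc]
    · exact ih.tail ⟨hbc, hT c c.2 hc⟩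

theorem reflTransGen_induced_of_innerRel {D : Digraph W} {T : Set W} {r : T} {v : W}
    (h : ReflTransGen (innerRel D.Adj T) r v) (hv : v ∈ T) :
    ReflTransGen (inducedDigraph D T).Adj r ⟨v, hv⟩ := by
  induction h with
  | refl => exact .refl
  | tail _ hbc ih => exact (ih (hbc.2 _ hbc.1)).tail hbc.1

namespace WeightedDigraph

variable {V : Type*} {G : WeightedDigraph V} {T : Set V}

theorem condC1_and_condC2_iff_exists :
    G.CondC1 T ∧ G.CondC2 T ↔
      ∃ r : T, IsRootNode (inducedDigraph G.toDigraph T) r ∧ G.entryNodes T ⊆ {(r : V)} := by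
  constructor
  · rintro ⟨⟨r, hr⟩, hempty | ⟨s, hs, hsingle⟩⟩
    · exact ⟨r, hr, hempty ▸ Set.empty_subset _⟩
    · exact ⟨s, hs, hsingle.subset⟩
  · rintro ⟨r, hr, hentry⟩
    exact ⟨⟨r, hr⟩, (Set.subset_singleton_iff_eq.1 hentry).imp_right fun h => ⟨r, hr, h⟩⟩

theorem condC1_and_condC2_iff_isRootedSet :
    G.CondC1 T ∧ G.CondC2 T ↔ IsRootedSet G.Adj T := by
  rw [condC1_and_condC2_iff_exists]
  constructor
  · rintro ⟨r, hr, hentry⟩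
    refine ⟨r, r.2, fun v hv => reflTransGen_innerRel_of_induced (v := ⟨v, hv⟩) ?_
      (isRootNode_iff.1 hr _)⟩
    exact fun i hi hir k hk => by_contra fun hkT => hir (hentry ⟨hi, k, hkT, hk⟩)
  · rintro ⟨r, hr, hreach⟩
    refine ⟨⟨r, hr⟩, isRootNode_iff.2 fun v =>
      reflTransGen_induced_of_innerRel (hreach v v.2) v.2, ?_⟩
    rintro v ⟨hv, k, hk, hkv⟩
    rcases (hreach v hv).cases_tail with hvr | ⟨u, _, huv⟩
    · exact hvr
    · exact absurd (huv.2 k hkv) hk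

variable [Fintype V]

theorem eq_of_reflTransGen_innerRel {l : V → ℝ} (hl : G.laplacian.mulVec l = 0) {r v : V}
    (hv : ReflTransGen (innerRel G.Adj T) r v) (hmax : ∀ u ∈ T, l u ≤ l v) : l r = l v := by
  induction hv with
  | refl => rfl
  | tail _ hbc ih =>
    have hb := eq_of_adj_of_laplacian_mulVec_eq_zero (congrFun hl _)
      (fun k hk => hmax k (hbc.2 k hk)) hbc.1
    rw [← hb] at hmax ⊢
    exact ih hmax

end WeightedDigraph

namespace IsRootedSet

variable {V : Type*} [Fintype V] {G : WeightedDigraph V} {T : Set V}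

theorem exists_forall_eq (hT : IsRootedSet G.Adj T) {l : V → ℝ}
    (hl : G.laplacian.mulVec l = 0) : ∃ c, ∀ i ∈ T, l i = c := by
  obtain ⟨r, hr, hreach⟩ := hT
  obtain ⟨a, ha, hmax⟩ := Set.exists_max_image T l T.toFinite ⟨r, hr⟩
  obtain ⟨b, hb, hmin⟩ := Set.exists_min_image T l T.toFinite ⟨r, hr⟩
  have hra : l r = l a := WeightedDigraph.eq_of_reflTransGen_innerRel hl (hreach a ha) hmax
  have hrb : (-l) r = (-l) b :=
    WeightedDigraph.eq_of_reflTransGen_innerRel (by rw [Matrix.mulVec_neg, hl, neg_zero])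
      (hreach b hb) fun u hu => neg_le_neg (hmin u hu)
  exact ⟨l r, fun i hi =>
    le_antisymm (hra ▸ hmax i hi) (neg_injective hrb ▸ hmin i hi)⟩

theorem convergesIdentically (hT : IsRootedSet G.Adj T) : G.ConvergesIdentically T := by
  intro H hH x hx
  rw [← hH] at hT
  obtain ⟨l, hlim, hl⟩ := hx.exists_tendsto
  obtain ⟨c, hc⟩ := hT.exists_forall_eq hl
  exact ⟨c, fun i hi => hc i hi ▸ tendsto_pi_nhds.1 hlim i⟩

end IsRootedSet

end Reachability

section Balanced

open Relation

variable {W : Type*} {E : W → W → Prop}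

/-- `h` has a smaller value at some predecessor of `i` if and only if it has a larger one at
another. These are the functions that are equilibria for some choice of positive edge weights. -/
def IsBalanced {α : Type*} [LT α] (E : W → W → Prop) (h : W → α) : Prop :=
  ∀ i, (∃ j, E j i ∧ h j < h i) ↔ ∃ j, E j i ∧ h i < h j

/-- The edges of `E` whose head has the same value of `h` as all its predecessors: these are the
heads at which a second function that breaks the ties of `h` still has to be balanced. -/
def levelRel {α : Type*} (E : W → W → Prop) (h : W → α) (j i : W) : Prop :=
  innerRel E {k | h k = h i} j i

theorem apply_eq_of_reflTransGen_levelRel {α : Type*} {h : W → α} {i j : W}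
    (hji : ReflTransGen (levelRel E h) j i) : h j = h i := by
  induction hji with
  | refl => rfl
  | tail _ hbc ih => exact ih.trans (hbc.2 _ hbc.1)

theorem isRootedSet_of_forall_exists_common_ancestor {α : Type*} [Finite W] {h : W → α} {i₀ : W}
    (hcommon : ∀ a b, h a = h i₀ → h b = h i₀ →
      ∃ u, ReflTransGen (levelRel E h) u a ∧ ReflTransGen (levelRel E h) u b) :
    IsRootedSet E {i | h i = h i₀} := by
  have hdir : Directed (Function.swap (ReflTransGen (levelRel E h)))
      (Subtype.val : {i | h i = h i₀} → W) := by
    rintro ⟨a, ha⟩ ⟨b, hb⟩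
    obtain ⟨u, hua, hub⟩ := hcommon a b ha hb
    exact ⟨⟨u, (apply_eq_of_reflTransGen_levelRel hua).trans ha⟩, hua, hub⟩
  have : IsTrans W (Function.swap (ReflTransGen (levelRel E h))) :=
    ⟨fun _ _ _ hab hbc => hbc.trans hab⟩
  have : Nonempty {i | h i = h i₀} := ⟨⟨i₀, rfl⟩⟩
  obtain ⟨⟨r, hr⟩, hreach⟩ := hdir.finite_le id
  refine ⟨r, hr, fun v hv => ?_⟩
  have hrv : ReflTransGen (levelRel E h) r v := hreach ⟨v, hv⟩
  induction hrv with
  | refl => exact .refl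
  | @tail b c _ hbc ih =>
    have hb : h b = h i₀ := (hbc.2 b hbc.1).trans hv
    exact (ih hb).tail ⟨hbc.1, fun k hk => (hbc.2 k hk).trans hv⟩

namespace IsBalanced

variable {α β : Type*} [LinearOrder α] [LinearOrder β] {h : W → α} {g : W → β}

theorem toLex (hh : IsBalanced E h) (hg : IsBalanced (levelRel E h) g) :
    IsBalanced E fun i => toLex (h i, g i) := by
  intro i
  simp only [Prod.Lex.toLex_lt_toLex]
  by_cases hlevel : ∀ k, E k i → h k = h i
  · have hlevelRel : ∀ j, levelRel E h j i ↔ E j i := fun j => and_iff_left hlevel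
    have hgi := hg i
    simp only [hlevelRel] at hgi
    have hdown : ∀ j, E j i ∧ (h j < h i ∨ h j = h i ∧ g j < g i) ↔ E j i ∧ g j < g i :=
      fun j => and_congr_right fun hj => by simp [hlevel j hj]
    have hup : ∀ j, E j i ∧ (h i < h j ∨ h i = h j ∧ g i < g j) ↔ E j i ∧ g i < g j :=
      fun j => and_congr_right fun hj => by simp [hlevel j hj]
    simpa only [hdown, hup] using hgi
  · push Not at hlevel
    obtain ⟨k, hk, hne⟩ := hlevel
    have hboth : (∃ j, E j i ∧ h j < h i) ∧ ∃ j, E j i ∧ h i < h j := by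
      rcases hne.lt_or_gt with hlt | hlt
      · exact ⟨⟨k, hk, hlt⟩, (hh i).1 ⟨k, hk, hlt⟩⟩
      · exact ⟨(hh i).2 ⟨k, hk, hlt⟩, ⟨k, hk, hlt⟩⟩
    obtain ⟨⟨j, hj, hjlt⟩, l, hl, hllt⟩ := hboth
    exact ⟨fun _ => ⟨l, hl, .inl hllt⟩, fun _ => ⟨j, hj, .inl hjlt⟩⟩

theorem exists_real [Countable W] (hh : IsBalanced E h) :
    ∃ f : W → ℝ, IsBalanced E f ∧ ∀ i j, f i = f j ↔ h i = h j := by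
  have := (Set.countable_range h).to_subtype
  obtain ⟨e⟩ := Order.embedding_from_countable_to_dense (Set.range h) ℝ
  refine ⟨fun i => e (Set.rangeFactorization h i), fun i => ?_, fun i j =>
    e.eq_iff_eq.trans Subtype.ext_iff⟩
  simpa only [e.lt_iff_lt, ← Subtype.coe_lt_coe, Set.rangeFactorization_coe] using hh i

end IsBalanced

theorem exists_neg_iff_exists_pos_of_sum_eq_zero {ι R : Type*} [AddCommGroup R] [LinearOrder R]
    [IsOrderedAddMonoid R] {s : Finset ι} {d : ι → R} (hd : ∑ k ∈ s, d k = 0) :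
    (∃ k ∈ s, d k < 0) ↔ ∃ k ∈ s, 0 < d k := by
  constructor
  · rintro ⟨k, hk, hlt⟩
    exact s.exists_pos_of_sum_zero_of_exists_nonzero d hd ⟨k, hk, hlt.ne⟩
  · rintro ⟨k, hk, hlt⟩
    obtain ⟨l, hl, hpos⟩ := s.exists_pos_of_sum_zero_of_exists_nonzero (fun k => -d k)
      (by rw [Finset.sum_neg_distrib, hd, neg_zero]) ⟨k, hk, neg_ne_zero.2 hlt.ne'⟩
    exact ⟨l, hl, neg_pos.1 hpos⟩

open Classical in
theorem exists_harmonic_extension [Fintype W] (E : W → W → Prop) (D : Set W)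
    (φ : W → Set.Icc (0 : ℝ) 1) : ∃ g : W → Set.Icc (0 : ℝ) 1,
      (∀ i ∈ D, g i = φ i) ∧ ∀ i ∉ D, ∑ j with E j i, ((g j : ℝ) - g i) = 0 := by
  let average (g : W → Set.Icc (0 : ℝ) 1) (i : W) : ℝ :=
    (∑ j with E j i, (g j : ℝ)) / (Finset.univ.filter (E · i)).card
  have haverage : ∀ g i, average g i ∈ Set.Icc (0 : ℝ) 1 := by
    refine fun g i => ⟨div_nonneg (Finset.sum_nonneg fun j _ => (g j).2.1) (Nat.cast_nonneg _),
      div_le_one_of_le₀ ?_ (Nat.cast_nonneg _)⟩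
    simpa using Finset.sum_le_card_nsmul (Finset.univ.filter (E · i)) (fun j => (g j : ℝ)) 1
      fun j _ => (g j).2.2
  let step : (W → Set.Icc (0 : ℝ) 1) →o (W → Set.Icc (0 : ℝ) 1) :=
    { toFun := fun g i => if i ∈ D then φ i else ⟨average g i, haverage g i⟩
      monotone' := by
        intro g g' hg i
        dsimp only
        split_ifs
        · exact le_rfl
        · exact Subtype.mk_le_mk.2 (div_le_div_of_nonneg_right
            (Finset.sum_le_sum fun j _ => hg j) (Nat.cast_nonneg _)) }
  have hfix : ∀ i, step.lfp i = if i ∈ D then φ i else ⟨average step.lfp i, haverage _ i⟩ :=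
    fun i => (congrFun step.map_lfp i).symm
  refine ⟨step.lfp, fun i hi => (hfix i).trans (if_pos hi), fun i hi => ?_⟩
  have hmean : (step.lfp i : ℝ) = average step.lfp i := by
    rw [hfix i, if_neg hi]
  rw [Finset.sum_sub_distrib, Finset.sum_const, nsmul_eq_mul, hmean, sub_eq_zero]
  rcases (Finset.univ.filter (E · i)).eq_empty_or_nonempty with hs | hs
  · simp [hs]
  · exact (mul_div_cancel₀ _ (Nat.cast_ne_zero.2 hs.card_ne_zero)).symm

theorem exists_isBalanced_of_disjoint [Finite W] {A B : Set W}
    (hA : ∀ i ∈ A, ∀ j, E j i → j ∈ A) (hB : ∀ i ∈ B, ∀ j, E j i → j ∈ B) (hAB : Disjoint A B) :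
    ∃ g : W → ℝ, IsBalanced E g ∧ (∀ i ∈ A, g i = 1) ∧ ∀ i ∈ B, g i = 0 := by
  classical
  have := Fintype.ofFinite W
  obtain ⟨g, hgD, hharm⟩ := exists_harmonic_extension E (A ∪ B) (A.indicator 1)
  have hgA : ∀ i ∈ A, (g i : ℝ) = 1 := fun i hi => by
    rw [hgD i (.inl hi), Set.indicator_of_mem hi, Pi.one_apply, Set.Icc.coe_one]
  have hgB : ∀ i ∈ B, (g i : ℝ) = 0 := fun i hi => by
    rw [hgD i (.inr hi), Set.indicator_of_notMem (hAB.notMem_of_mem_right hi), Set.Icc.coe_zero]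
  refine ⟨fun i => g i, fun i => ?_, hgA, hgB⟩
  have hconst (hE : ∀ j, E j i → (g j : ℝ) = g i) :
      (∃ j, E j i ∧ (g j : ℝ) < g i) ↔ ∃ j, E j i ∧ (g i : ℝ) < g j :=
    iff_of_false (fun ⟨j, hj, hlt⟩ => hlt.ne (hE j hj)) fun ⟨j, hj, hlt⟩ => hlt.ne' (hE j hj)
  by_cases hiA : i ∈ A
  · exact hconst fun j hj => (hgA j (hA i hiA j hj)).trans (hgA i hiA).symm
  by_cases hiB : i ∈ B
  · exact hconst fun j hj => (hgB j (hB i hiB j hj)).trans (hgB i hiB).symm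
  simpa using exists_neg_iff_exists_pos_of_sum_eq_zero (hharm i (not_or.2 ⟨hiA, hiB⟩))

theorem exists_isBalanced_ne [Finite W] {a b : W}
    (hab : ∀ u, ReflTransGen E u a → ¬ ReflTransGen E u b) :
    ∃ g : W → ℝ, IsBalanced E g ∧ g a ≠ g b := by
  obtain ⟨g, hg, hga, hgb⟩ := exists_isBalanced_of_disjoint
    (A := {u | ReflTransGen E u a}) (B := {u | ReflTransGen E u b})
    (fun _ hi _ hj => .head hj hi) (fun _ hi _ hj => .head hj hi) (Set.disjoint_left.2 hab)
  exact ⟨g, hg, by rw [hga a .refl, hgb b .refl]; exact one_ne_zero⟩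

theorem IsBalanced.exists_ker_lt [Finite W] {α : Type*} [LinearOrder α] {h : W → α}
    (hh : IsBalanced E h) {i₀ : W} (hroot : ¬ IsRootedSet E {i | h i = h i₀}) :
    ∃ f : W → ℝ, IsBalanced E f ∧ Setoid.ker f < Setoid.ker h := by
  obtain ⟨a, b, ha, hb, hab⟩ : ∃ a b, h a = h i₀ ∧ h b = h i₀ ∧
      ∀ u, ReflTransGen (levelRel E h) u a → ¬ ReflTransGen (levelRel E h) u b := by
    contrapose! hroot
    exact isRootedSet_of_forall_exists_common_ancestor hroot
  obtain ⟨g, hg, hne⟩ := exists_isBalanced_ne hab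
  obtain ⟨f, hf, hker⟩ := (hh.toLex hg).exists_real
  simp only [toLex_inj, Prod.mk.injEq] at hker
  exact ⟨f, hf, fun i j hij => ((hker i j).1 hij).1,
    fun hle => hne ((hker a b).1 (hle (ha.trans hb.symm))).2⟩

theorem exists_isBalanced_forall_isRootedSet [Finite W] (E : W → W → Prop) :
    ∃ h : W → ℝ, IsBalanced E h ∧ ∀ i, IsRootedSet E {j | h j = h i} := by
  have : Finite (Setoid W) := Finite.of_injective (fun s : Setoid W => s.r) fun _ _ h =>
    Setoid.ext fun i j => iff_of_eq (congrFun₂ h i j)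
  have hzero : IsBalanced E (0 : W → ℝ) := fun i => by simp
  obtain ⟨h, hh, hmin⟩ := exists_minimalFor_of_wellFoundedLT (IsBalanced (α := ℝ) E) Setoid.ker
    ⟨0, hzero⟩
  refine ⟨h, hh, fun i => by_contra fun hroot => ?_⟩
  obtain ⟨f, hf, hlt⟩ := hh.exists_ker_lt hroot
  exact hlt.not_ge (hmin hf hlt.le)

end Balanced

section Weights

theorem exists_forall_pos_sum_mul_eq_zero {ι R : Type*} [CommRing R] [LinearOrder R]
    [IsStrictOrderedRing R] {s : Finset ι} {d : ι → R}
    (hd : (∃ k ∈ s, d k < 0) ↔ ∃ k ∈ s, 0 < d k) :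
    ∃ w : ι → R, (∀ k, 0 < w k) ∧ ∑ k ∈ s, w k * d k = 0 := by
  classical
  by_cases hpos : ∃ k ∈ s, 0 < d k
  · obtain ⟨p, hp, hdp⟩ := hpos
    obtain ⟨n, hn, hdn⟩ := hd.2 ⟨p, hp, hdp⟩
    have hup : 0 < ∑ k ∈ s, (d k)⁺ := Finset.sum_pos' (fun k _ => posPart_nonneg _)
      ⟨p, hp, posPart_pos hdp⟩
    have hdown : 0 < ∑ k ∈ s, (d k)⁻ := Finset.sum_pos' (fun k _ => negPart_nonneg _)
      ⟨n, hn, negPart_pos hdn⟩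
    refine ⟨fun k => if 0 < d k then ∑ l ∈ s, (d l)⁻ else ∑ l ∈ s, (d l)⁺,
      fun k => by dsimp only; split_ifs <;> assumption, ?_⟩
    have hterm : ∀ k, (if 0 < d k then ∑ l ∈ s, (d l)⁻ else ∑ l ∈ s, (d l)⁺) * d k =
        (∑ l ∈ s, (d l)⁻) * (d k)⁺ - (∑ l ∈ s, (d l)⁺) * (d k)⁻ := by
      intro k
      split_ifs with hk
      · rw [posPart_of_nonneg hk.le, negPart_of_nonneg hk.le, mul_zero, sub_zero]
      · rw [posPart_of_nonpos (not_lt.1 hk), negPart_of_nonpos (not_lt.1 hk), mul_zero, zero_sub,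
          mul_neg, neg_neg]
    simp only [hterm, Finset.sum_sub_distrib, ← Finset.mul_sum]
    rw [mul_comm, sub_self]
  · have hneg := mt hd.1 hpos
    push Not at hpos hneg
    exact ⟨1, fun _ => one_pos, Finset.sum_eq_zero fun k hk => by
      rw [le_antisymm (hpos k hk) (hneg k hk), mul_zero]⟩

namespace WeightedDigraph

variable {V : Type*}

open Classical in
/-- The digraph of `G` with the weight of each edge `(j, i)` replaced by `w i j`;
the values of `w` off the edges are ignored. -/
noncomputable def withWeights (G : WeightedDigraph V) (w : V → V → ℝ) (hw : ∀ i j, 0 < w i j) :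
    WeightedDigraph V where
  toDigraph := G.toDigraph
  loopless := G.loopless
  weight := Matrix.of fun i j => if G.Adj j i then w i j else 0
  weight_nonneg i j := by
    rw [Matrix.of_apply]
    split_ifs
    exacts [(hw i j).le, le_rfl]
  weight_pos_iff i j := by
    rw [Matrix.of_apply]
    split_ifs with hadj
    exacts [iff_of_true (hw i j) hadj, iff_of_false (lt_irrefl 0) hadj]

variable [Fintype V] {G : WeightedDigraph V}

theorem exists_laplacian_mulVec_eq_zero_of_isBalanced {h : V → ℝ} (hh : IsBalanced G.Adj h) :
    ∃ H : WeightedDigraph V, H.toDigraph = G.toDigraph ∧ H.laplacian.mulVec h = 0 := by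
  classical
  have hweights : ∀ i, ∃ w : V → ℝ, (∀ k, 0 < w k) ∧
      ∑ k with G.Adj k i, w k * (h i - h k) = 0 := fun i =>
    exists_forall_pos_sum_mul_eq_zero (by simpa using (hh i).symm)
  choose w hw hsum using hweights
  refine ⟨G.withWeights w hw, rfl, funext fun i => ?_⟩
  rw [laplacian_mulVec_apply, Pi.zero_apply, ← hsum i, Finset.sum_filter]
  simp only [withWeights, Matrix.of_apply, ite_mul, zero_mul]

theorem ConvergesIdentically.exists_isRootedSet [Nonempty V] {S : Set V}
    (hS : G.ConvergesIdentically S) : ∃ T, S ⊆ T ∧ IsRootedSet G.Adj T := by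
  obtain ⟨h, hh, hrooted⟩ := exists_isBalanced_forall_isRootedSet G.Adj
  obtain ⟨H, hH, hker⟩ := exists_laplacian_mulVec_eq_zero_of_isBalanced hh
  obtain ⟨c, hc⟩ := hS H hH _ (isTrajectory_const hker)
  have hSc : ∀ i ∈ S, h i = c := fun i hi => tendsto_nhds_unique tendsto_const_nhds (hc i hi)
  rcases S.eq_empty_or_nonempty with rfl | ⟨s, hs⟩
  · exact ⟨_, Set.empty_subset _, hrooted (Classical.arbitrary V)⟩
  · exact ⟨_, fun i hi => (hSc i hi).trans (hSc s hs).symm, hrooted s⟩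

end WeightedDigraph

end Weights

theorem theorem1 {V : Type*} [Fintype V] [Nonempty V] (G : WeightedDigraph V) (S : Set V) :
    G.IsTopologicalCluster S ↔
      Maximal (fun T : Set V => G.CondC1 T ∧ G.CondC2 T) S := by
  simp only [WeightedDigraph.condC1_and_condC2_iff_isRootedSet]
  exact maximal_iff_maximal_of_imp_of_forall (fun _ hT => IsRootedSet.convergesIdentically hT)
    fun _ hT => hT.exists_isRootedSet
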